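/- Let $K=\mathrm{SU}(2)$, $U=K\times K$, $m_t=\mathrm{diag}(e^{it/2},e^{-it/2})$ and $a_t=(m_t,m_{-t})\in U$ for $t\in\mathbb R$. For $\ell\in\frac12\mathbb N=\{0,\frac12,1,\dots\}$ let $H^\ell=\mathbb C[x,y]_{2\ell}$ be the space of homogeneous polynomials of degree $2\ell$, with the representation $T^\ell(k)f=f\circ k^{t}$ of $K$ (here $k^t$ is the transpose of $k$), and with the inner product for which the vectors $\psi^\ell_j=\binom{2\ell}{\ell-j}^{1/2}x^{\ell-j}y^{\ell+j}$, $j=-\ell,-\ell+1,\dots,\ell$, form an orthonormal basis. For $\ell_1,\ell_2\in\frac12\mathbb N$ let $T^{\ell_1,\ell_2}(k_1,k_2)=T^{\ell_1}(k_1)\otimes T^{\ell_2}(k_2)$ be the representation of $U$ on $H^{\ell_1}\otimes H^{\ell_2}$. If $T^\ell$ occurs in the restriction of $T^{\ell_1,\ell_2}$ to the diagonal subgroup $\{(k,k):k\in K\}$, let $\Phi^\ell_{\ell_1,\ell_2}(x)=\beta^*\circ T^{\ell_1,\ell_2}(x)\circ\beta\in\mathrm{End}(H^\ell)$ for $x\in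 U$, where $\beta:H^\ell\to H^{\ell_1}\otimes H^{\ell_2}$ is an isometric $K$-intertwiner (unique up to a factor of modulus one, which does not affect $\Phi^\ell_{\ell_1,\ell_2}$). Let $\Phi^\ell_0(a_t)$ be the matrix, with rows and columns indexed by $-\ell,\dots,\ell$, whose entries are $$\bigl(\Phi_0^\ell(a_t)\bigr)_{p,q}=\bigl\langle \Phi^\ell_{(\ell+p)/2,(\ell-p)/2}(a_t)\psi^\ell_q,\psi^\ell_q\bigr\rangle ,$$ and define the weight matrix $$V^\ell(a_t)=\sin^2(t)\,\Phi_0^\ell(a_t)\,\Phi_0^\ell(a_t)^* .$$ **Theorem.** Let $\ell\in\frac12\mathbb N$ and $p,q\in\{-\ell,-\ell+1,\dots,\ell\}$. (a) Suppose that $q-p\le 0$ and $q+p\le 0$. For $n=0,\dots,\ell+q$ let $$c_n^\ell(p,q)=\frac{2\ell+1}{\ell+p+1}\,\frac{(\ell-q)!\,(\ell+q)!}{(2\ell)!}\,\frac{(p-\ell)_{\ell+q-n}}{(\ell+p+2)_{\ell+q-n}}\,(-1)^{\ell+q-n}\,\frac{(2\ell+2-n)_n}{n!},$$ where $(x)_k=x(x+1)\cdots(x+k-1)$.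 Then every $c^\ell_n(p,q)$ is a positive rational number, and for all $t\in\mathbb R$ $$\bigl(V^\ell(a_t)\bigr)_{p,q}=\sin^2(t)\sum_{n=0}^{\ell+q}c_n^\ell(p,q)\,U_{2\ell+p+q-2n}(\cos t),$$ where $U_k$ is the Chebyshev polynomial of the second kind of degree $k$. (b) For all $p,q\in\{-\ell,\dots,\ell\}$ and all $t\in\mathbb R$, $$V^\ell(a_t)_{p,q}=V^\ell(a_t)_{q,p}=V^\ell(a_t)_{-p,-q}=V^\ell(a_t)_{-q,-p},$$ so that (a) determines all entries of $V^\ell$. -/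

import Mathlib

open scoped TensorProduct Matrix Nat

noncomputable section

namespace SU2Pair

/-! Half-integers are encoded by doubling: a natural number `N` stands for the spin `ℓ = N / 2`,
and an index `i : Fin (N + 1)` stands for the weight `i - ℓ ∈ {-ℓ, -ℓ + 1, …, ℓ}`. -/

/-- The spin `ℓ = N / 2`. -/
def spin (N : ℕ) : ℚ := (N : ℚ) / 2

/-- The element `i - ℓ` of `{-ℓ, …, ℓ}`, where `ℓ = N / 2`. -/
def wt (N : ℕ) (i : Fin (N + 1)) : ℚ := (i : ℚ) - spin N

/-- The group `K = SU(2)`. -/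
abbrev K : Type := Matrix.specialUnitaryGroup (Fin 2) ℂ

/-- The group `U = K × K`; the subgroup `K_*` consists of the pairs `(k, k)`. -/
abbrev U : Type := K × K

/-- The space `H^ℓ = ℂ[x, y]_{2ℓ}` of homogeneous polynomials of degree `N = 2ℓ` in two variables
(`x` is the variable `0` and `y` is the variable `1`). -/
abbrev H (N : ℕ) : Type := MvPolynomial.homogeneousSubmodule (Fin 2) ℂ N

/-- The exponent vector of `x ^ (N - m) * y ^ m`. -/
def expo (N : ℕ) (m : Fin (N + 1)) : Fin 2 →₀ ℕ :=
  Finsupp.single 0 (N - (m : ℕ)) + Finsupp.single 1 (m : ℕ)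

lemma expo_zero (N : ℕ) (m : Fin (N + 1)) : expo N m 0 = N - m := by simp [expo]

lemma expo_one (N : ℕ) (m : Fin (N + 1)) : expo N m 1 = m := by simp [expo]

lemma expo_degree (N : ℕ) (m : Fin (N + 1)) : (expo N m).degree = N := by
  have := m.is_lt
  simp [Finsupp.degree_eq_sum, expo]
  omega

lemma expo_injective (N : ℕ) : Function.Injective (expo N) := fun a b h => by
  have := congrArg (fun f => f 1) h
  simp only [expo_one] at this
  exact Fin.ext this

/-- The vector `ψ_j = binom(2ℓ, ℓ - j)^(1/2) x^(ℓ - j) y^(ℓ + j)` of `H^ℓ`, where `m = ℓ + j`. -/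
def psi (N : ℕ) (m : Fin (N + 1)) : H N :=
  ⟨MvPolynomial.monomial (expo N m) ((Real.sqrt (N.choose (N - (m : ℕ))) : ℝ) : ℂ), by
    rw [MvPolynomial.mem_homogeneousSubmodule]
    exact MvPolynomial.isHomogeneous_monomial _ (expo_degree N m)⟩

lemma sqrt_choose_ne_zero (N : ℕ) (m : Fin (N + 1)) :
    ((Real.sqrt (N.choose (N - (m : ℕ))) : ℝ) : ℂ) ≠ 0 := by
  have h : 0 < N.choose (N - (m : ℕ)) := Nat.choose_pos (Nat.sub_le _ _)
  have h' : (0 : ℝ) < (N.choose (N - (m : ℕ)) : ℝ) := by exact_mod_cast h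
  exact_mod_cast (Real.sqrt_pos.2 h').ne'

/-- The coordinates of a polynomial in `H^ℓ` with respect to the vectors `ψ_j`. -/
def coords (N : ℕ) : H N →ₗ[ℂ] EuclideanSpace ℂ (Fin (N + 1)) where
  toFun f := WithLp.toLp 2 fun m =>
    MvPolynomial.coeff (expo N m) (f : MvPolynomial (Fin 2) ℂ) /
      ((Real.sqrt (N.choose (N - (m : ℕ))) : ℝ) : ℂ)
  map_add' f g := by
    ext m
    simp [add_div]
  map_smul' c f := by
    ext m
    simp [mul_div_assoc]

lemma coords_psi (N : ℕ) (m : Fin (N + 1)) : coords N (psi N m) = EuclideanSpace.single m 1 := by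
  ext k
  by_cases h : k = m
  · subst h
    have h := sqrt_choose_ne_zero N k
    simp only [coords, psi, LinearMap.coe_mk, AddHom.coe_mk, MvPolynomial.coeff_monomial, if_true,
      PiLp.single_apply]
    exact div_self h
  · have h' : expo N m ≠ expo N k := fun e => h (expo_injective N e).symm
    simp [coords, psi, h, h', MvPolynomial.coeff_monomial]

lemma coords_injective (N : ℕ) : Function.Injective (coords N) := by
  rw [← LinearMap.ker_eq_bot, LinearMap.ker_eq_bot']
  intro f hf
  apply Subtype.ext
  apply MvPolynomial.ext
  intro d
  by_cases hd : d.degree = N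
  · have hsum : d 0 + d 1 = N := by
      rw [← hd, Finsupp.degree_eq_sum, Fin.sum_univ_two]
    have hlt : d 1 < N + 1 := by omega
    have hexp : expo N ⟨d 1, hlt⟩ = d := by
      ext i
      fin_cases i
      · simp [expo]
        omega
      · simp [expo]
    have h1 : coords N f ⟨d 1, hlt⟩ = 0 := by
      rw [hf]
      rfl
    have h2 : MvPolynomial.coeff (expo N ⟨d 1, hlt⟩) (f : MvPolynomial (Fin 2) ℂ) /
      ((Real.sqrt (N.choose (N - (⟨d 1, hlt⟩ : Fin (N + 1)))) : ℝ) : ℂ) = 0 := h1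
    rcases div_eq_zero_iff.1 h2 with h3 | h3
    · rw [hexp] at h3
      simpa using h3
    · exact absurd h3 (sqrt_choose_ne_zero N _)
  · have hf' : (f : MvPolynomial (Fin 2) ℂ).IsHomogeneous N :=
      (MvPolynomial.mem_homogeneousSubmodule _ _).1 f.2
    simpa using hf'.coeff_eq_zero hd

lemma coords_surjective (N : ℕ) : Function.Surjective (coords N) := by
  intro v
  refine ⟨∑ m, v m • psi N m, ?_⟩
  ext k
  simp [map_sum, coords_psi, Pi.single_apply]

/-- The inner product on `H^ℓ` for which the vectors `ψ_j` are orthonormal. -/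
@[reducible] def innerCore (N : ℕ) : InnerProductSpace.Core ℂ (H N) where
  inner f g := inner ℂ (coords N f) (coords N g)
  conj_inner_symm f g := inner_conj_symm _ _
  re_inner_nonneg f := inner_self_nonneg
  add_left f g h := by rw [map_add, inner_add_left]
  smul_left f g c := by rw [map_smul, inner_smul_left]
  definite f h := by
    apply coords_injective N
    rw [map_zero]
    exact inner_self_eq_zero.1 h

instance instNormedAddCommGroupH (N : ℕ) : NormedAddCommGroup (H N) :=
  (innerCore N).toNormedAddCommGroup

instance instInnerProductSpaceH (N : ℕ) : InnerProductSpace ℂ (H N) :=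
  InnerProductSpace.ofCore (innerCore N).toCore

/-- The vectors `ψ_j`, `j = -ℓ, …, ℓ`, as an orthonormal basis of `H^ℓ`. -/
def psiBasis (N : ℕ) : OrthonormalBasis (Fin (N + 1)) ℂ (H N) :=
  OrthonormalBasis.ofRepr
    { LinearEquiv.ofBijective (coords N) ⟨coords_injective N, coords_surjective N⟩ with
      norm_map' := fun f => by
        rw [norm_eq_sqrt_re_inner (𝕜 := ℂ), norm_eq_sqrt_re_inner (𝕜 := ℂ)]
        rfl }

lemma psiBasis_apply (N : ℕ) (m : Fin (N + 1)) : psiBasis N m = psi N m := by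
  apply coords_injective N
  rw [coords_psi]
  exact (psiBasis N).repr_self m

instance instFiniteDimensionalH (N : ℕ) : FiniteDimensional ℂ (H N) :=
  (psiBasis N).toBasis.finiteDimensional_of_finite

/-- Substitution of `kᵗ (x, y)` for `(x, y)`, that is `f ↦ f ∘ kᵗ`. -/
def subst (k : Matrix (Fin 2) (Fin 2) ℂ) :
    MvPolynomial (Fin 2) ℂ →ₐ[ℂ] MvPolynomial (Fin 2) ℂ :=
  MvPolynomial.aeval fun i => ∑ j, MvPolynomial.C (kᵀ i j) * MvPolynomial.X j

lemma eval_subst (k : Matrix (Fin 2) (Fin 2) ℂ) (f : MvPolynomial (Fin 2) ℂ) (v : Fin 2 → ℂ) :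
    MvPolynomial.eval v (subst k f) = MvPolynomial.eval (kᵀ *ᵥ v) f := by
  induction f using MvPolynomial.induction_on with
  | C a => simp [subst]
  | add f g hf hg => simp [hf, hg]
  | mul_X f i hf =>
    rw [map_mul, map_mul, map_mul, hf, MvPolynomial.eval_X]
    congr 1
    simp only [subst, MvPolynomial.aeval_X, map_sum, map_mul, MvPolynomial.eval_C,
      MvPolynomial.eval_X]
    rfl

lemma subst_mem (k : Matrix (Fin 2) (Fin 2) ℂ) (N : ℕ) (f : H N) :
    subst k f ∈ MvPolynomial.homogeneousSubmodule (Fin 2) ℂ N := by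
  have hf : (f : MvPolynomial (Fin 2) ℂ).IsHomogeneous N :=
    (MvPolynomial.mem_homogeneousSubmodule _ _).1 f.2
  rw [MvPolynomial.mem_homogeneousSubmodule]
  have := hf.aeval (n := 1) (fun i => ∑ j, MvPolynomial.C (kᵀ i j) * MvPolynomial.X j)
    (fun i => MvPolynomial.IsHomogeneous.sum _ _ _ fun j _ => by
      simpa using (MvPolynomial.isHomogeneous_C (Fin 2) (kᵀ i j)).mul
        (MvPolynomial.isHomogeneous_X ℂ j))
  simpa [subst] using this

/-- The representation `T^ℓ` of `K` on `H^ℓ`, `T^ℓ(k) f = f ∘ kᵗ`. -/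
def T (N : ℕ) : Representation ℂ K (H N) where
  toFun k := (subst (k : Matrix (Fin 2) (Fin 2) ℂ)).toLinearMap.restrict
    (p := MvPolynomial.homogeneousSubmodule (Fin 2) ℂ N)
    (q := MvPolynomial.homogeneousSubmodule (Fin 2) ℂ N) fun f hf => subst_mem _ N ⟨f, hf⟩
  map_one' := by
    ext1 f
    apply Subtype.ext
    apply MvPolynomial.funext
    intro v
    simp [LinearMap.restrict_apply, eval_subst]
  map_mul' k₁ k₂ := by
    ext1 f
    apply Subtype.ext
    apply MvPolynomial.funext
    intro v
    change MvPolynomial.eval v (subst ((k₁ : Matrix (Fin 2) (Fin 2) ℂ) * k₂) f) =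
      MvPolynomial.eval v (subst (k₁ : Matrix (Fin 2) (Fin 2) ℂ) (subst k₂ f))
    rw [eval_subst, eval_subst, eval_subst, Matrix.transpose_mul, Matrix.mulVec_mulVec]

/-- The representation `T^{ℓ₁,ℓ₂}` of `U = K × K` on `H^{ℓ₁} ⊗ H^{ℓ₂}`, where `ℓ₁ = N₁ / 2` and
`ℓ₂ = N₂ / 2`: the outer tensor product `(k₁, k₂) ↦ T^{ℓ₁}(k₁) ⊗ T^{ℓ₂}(k₂)`. -/
def T₂ (N₁ N₂ : ℕ) : Representation ℂ U (H N₁ ⊗[ℂ] H N₂) :=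
  Representation.tprod ((T N₁).comp (MonoidHom.fst K K)) ((T N₂).comp (MonoidHom.snd K K))

/-- `β : H^ℓ → H^{ℓ₁} ⊗ H^{ℓ₂}` intertwines `T^ℓ` with the restriction of `T^{ℓ₁,ℓ₂}` to the
diagonal subgroup `K_*`. -/
def Intertwines (N₁ N₂ N : ℕ) (β : H N →ₗᵢ[ℂ] H N₁ ⊗[ℂ] H N₂) : Prop :=
  ∀ (k : K) (f : H N), β (T N k f) = T₂ N₁ N₂ (k, k) (β f)

open Classical in
/-- The spherical function `Φ^ℓ_{ℓ₁,ℓ₂}(x) = β* ∘ T^{ℓ₁,ℓ₂}(x) ∘ β` of type `ℓ = N / 2` associated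
with `(ℓ₁, ℓ₂) = (N₁ / 2, N₂ / 2)`, where `β` is an isometric `K`-intertwiner from `H^ℓ` to
`H^{ℓ₁} ⊗ H^{ℓ₂}`. Since the restriction of `T^{ℓ₁,ℓ₂}` to `K_*` is multiplicity free, `β` is
unique up to a factor of modulus one, and this factor cancels. The value `0` is used if `T^ℓ` does
not occur in that restriction. -/
def spherical (N₁ N₂ N : ℕ) (x : U) : H N →ₗ[ℂ] H N :=
  if h : ∃ β : H N →ₗᵢ[ℂ] H N₁ ⊗[ℂ] H N₂, Intertwines N₁ N₂ N β then
    LinearMap.adjoint h.choose.toLinearMap ∘ₗ T₂ N₁ N₂ x ∘ₗ h.choose.toLinearMap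
  else 0

/-- The matrix `diag(exp(it/2), exp(-it/2))`. -/
def mMat (t : ℝ) : Matrix (Fin 2) (Fin 2) ℂ :=
  Matrix.diagonal ![Complex.exp (Complex.I * t / 2), Complex.exp (-(Complex.I * t / 2))]

lemma mMat_mem (t : ℝ) : mMat t ∈ Matrix.specialUnitaryGroup (Fin 2) ℂ := by
  rw [Matrix.mem_specialUnitaryGroup_iff]
  have h2 : (starRingEnd ℂ) 2 = 2 := map_ofNat _ 2
  constructor
  · rw [Matrix.mem_unitaryGroup_iff, mMat, Matrix.star_eq_conjTranspose,
      Matrix.diagonal_conjTranspose, Matrix.diagonal_mul_diagonal, ← Matrix.diagonal_one]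
    congr 1
    ext i
    fin_cases i
    all_goals simp [← Complex.exp_conj, ← Complex.exp_add, h2, neg_div]
  · simp [mMat, Matrix.det_diagonal, ← Complex.exp_add]

/-- The element `m_t = diag(exp(it/2), exp(-it/2))` of the maximal torus of `K`. -/
def m (t : ℝ) : K := ⟨mMat t, mMat_mem t⟩

/-- The element `a_t = (m_t, m_{-t})` of `A_* ⊆ U`. -/
def a (t : ℝ) : U := (m t, m (-t))

/-- The full spherical function `Φ_d^ℓ` of type `ℓ = N / 2` and degree `d` at `x ∈ A_*`, as a matrix
in the basis `ψ_{-ℓ}, …, ψ_ℓ`. Its `(p, q)` entry is the `(q, q)` matrix entry of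
`Φ^ℓ_{ℓ₁,ℓ₂}(x)`, where `(ℓ₁, ℓ₂) = ((d + ℓ + p) / 2, (d + ℓ - p) / 2)`; for the index `p`, the
natural number `p` stands for `ℓ + p` and `N - p` for `ℓ - p`. -/
def fullSpherical (N d : ℕ) (x : U) : Matrix (Fin (N + 1)) (Fin (N + 1)) ℂ :=
  Matrix.of fun p q =>
    inner ℂ (psi N q) (spherical (d + (p : ℕ)) (d + (N - (p : ℕ))) N x (psi N q))

/-- The density `D_*(a_t) = sin² t`. -/
def Dstar (t : ℝ) : ℝ := Real.sin t ^ 2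

/-- The weight matrix `V^ℓ(a_t) = Φ_0^ℓ(a_t) (Φ_0^ℓ(a_t))* |D_*(a_t)|`, where `ℓ = N / 2`. -/
def V (N : ℕ) (t : ℝ) : Matrix (Fin (N + 1)) (Fin (N + 1)) ℂ :=
  ((|Dstar t| : ℝ) : ℂ) • (fullSpherical N 0 (a t) * (fullSpherical N 0 (a t))ᴴ)

/-- The Pochhammer symbol `(x)_n = x (x + 1) ⋯ (x + n - 1)`. -/
def poch (x : ℚ) (n : ℕ) : ℚ := ∏ k ∈ Finset.range n, (x + k)

/-- The coefficient `c_n^ℓ(p, q)`, where `ℓ = N / 2`. As natural numbers, `ℓ + q` is the index `q`,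
`ℓ - q` is `N - q`, and `2ℓ` is `N`; the coefficient is used only for `n ≤ ℓ + q`. -/
def coeffC (N : ℕ) (p q : Fin (N + 1)) (n : ℕ) : ℚ :=
  (2 * spin N + 1) / (spin N + wt N p + 1) *
    (((N - (q : ℕ))! : ℚ) * ((q : ℕ)! : ℚ) / (N ! : ℚ)) *
    (poch (wt N p - spin N) ((q : ℕ) - n) / poch (spin N + wt N p + 2) ((q : ℕ) - n)) *
    (-1) ^ ((q : ℕ) - n) *
    (poch (2 * spin N + 2 - n) n / (n ! : ℚ))

end SU2Pair

end

/-!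
Write `P, Q, R ∈ {0, …, N}` for `ℓ + p`, `ℓ + q`, … with `N = 2ℓ`. In degree `0` the representation
`T^ℓ` is the top constituent of `T^{ℓ₁,ℓ₂}`, since `ℓ₁ + ℓ₂ = ℓ`, and the intertwiner is the adjoint
of the multiplication of polynomials. It sends the power `(α x + γ y) ^ N` to
`(α x + γ y) ^ P ⊗ (α x + γ y) ^ (N - P)`, which shows at once that it is equivariant
(`intertwines_comultIsometry`) and that every other isometric intertwiner is a multiple of it by a
phase (`Intertwines.eq_smul_comult`). Its coefficients in the bases `ψ` are square roots of quotients
of binomial coefficients, so that the entries of `Φ_0^ℓ(a_t)` are explicit trigonometric sums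
(`fullSpherical_zero_apply`), in fact values of Krawtchouk polynomials.

With `z = exp(it)` and `w = exp(-it)`, the symmetry `Φ_{P,R} = Φ_{R,P}` (`entry_symm`) turns
`C(N, P) Φ_{P,R}` into a phase, depending on `R` only, times the coefficient of `s ^ P` in
`(1 + w s) ^ R (1 + z s) ^ (N - R)`. Hence `C(N, P) C(N, Q) ∑_R Φ_{P,R} conj(Φ_{Q,R})` is the
coefficient of `s ^ P u ^ Q` in the geometric sum `∑_R a ^ R b ^ (N - R)`, where
`a = (1 + w s)(1 + z u)` and `b = (1 + z s)(1 + w u)`. Because `a - b = (z - w)(u - s)`, the product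
of this sum with `(z - w)(u - s)` is `a ^ (N + 1) - b ^ (N + 1)`. Comparing coefficients gives a
recurrence along `P + Q = const`, whose solution (`mul_pairSum`) is
`∑_n C(N + 1, P + Q + 1 - n) C(N + 1, n) (z ^ (P + Q + 1 - 2n) - w ^ (P + Q + 1 - 2n))`.
Division by `z - w = 2i sin t` produces the Chebyshev polynomials `U_{P + Q - 2n}(cos t)`, and the
coefficients, divided by `C(N, P) C(N, Q)`, are the `c_n` (`coeffC_eq`), visibly positive.
The symmetries of the weight follow from those of `Φ_0^ℓ(a_t)`: reflecting an index amounts to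
complex conjugation (`entry_compl_left`, `entry_compl_right`).
-/

noncomputable section

namespace SU2Pair

/-! ### A bivariate generating function -/

section GeneratingFunction

open Polynomial Finset

variable {A : Type*} [CommRing A]

/-- The generating polynomial `(1 + w X) ^ R * (1 + z X) ^ (N - R)`. -/
def binProd (z w : A) (N R : ℕ) : A[X] := (1 + C w * X) ^ R * (1 + C z * X) ^ (N - R)

lemma coeff_one_add_C_mul_X_pow (z : A) (n k : ℕ) :
    ((1 + C z * X : A[X]) ^ n).coeff k = n.choose k * z ^ k := by
  have h : (1 + C z * X : A[X]) ^ n = ((1 + X) ^ n).comp (C z * X) := by simp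
  rw [h, comp_C_mul_X_coeff, coeff_one_add_X_pow]

lemma coeff_binProd (z w : A) (N R k : ℕ) :
    (binProd z w N R).coeff k = ∑ ij ∈ antidiagonal k,
      ((R.choose ij.1 : A) * w ^ ij.1) * (((N - R).choose ij.2 : A) * z ^ ij.2) := by
  simp only [binProd, coeff_mul, coeff_one_add_C_mul_X_pow]

lemma coeff_coeff_C_mul_map_C (f g : A[X]) (P Q : ℕ) :
    ((C f * g.map C : A[X][X]).coeff Q).coeff P = f.coeff P * g.coeff Q := by
  rw [coeff_C_mul, coeff_map, coeff_mul_C]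

/-- The coefficient of `s ^ P * u ^ Q` in `∑ R, F_R(s; z, w) * F_R(u; w, z)`, where `F_R(·; z, w)`
is `binProd z w N R`. -/
def pairSum (z w : A) (N P Q : ℕ) : A :=
  ∑ R ∈ range (N + 1), (binProd z w N R).coeff P * (binProd w z N R).coeff Q

/-- The sum over `R` is a geometric sum in `(1 + w s) (1 + z u)` and `(1 + z s) (1 + w u)`, two
quantities whose difference is `(z - w) (u - s)`. -/
lemma exists_generating_pairSum (z w : A) (N : ℕ) : ∃ G : A[X][X],
    (∀ P Q, (G.coeff Q).coeff P = (z - w) * pairSum z w N P Q) ∧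
    G * (X - C X) = C ((1 + C w * X) ^ (N + 1)) * ((1 + C z * X) ^ (N + 1)).map C -
      C ((1 + C z * X) ^ (N + 1)) * ((1 + C w * X) ^ (N + 1)).map C := by
  refine ⟨C (C (z - w)) * ∑ R ∈ range (N + 1), C (binProd z w N R) * (binProd w z N R).map C,
    fun P Q => ?_, ?_⟩
  · rw [coeff_C_mul, coeff_C_mul, finsetSum_coeff, finsetSum_coeff]
    simp only [coeff_coeff_C_mul_map_C, pairSum]
  · set a : A[X][X] := C (1 + C w * X) * (1 + C z * X : A[X]).map C with ha
    set b : A[X][X] := C (1 + C z * X) * (1 + C w * X : A[X]).map C with hb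
    have hab : C (C (z - w)) * (X - C X) = a - b := by
      simp only [ha, hb, Polynomial.map_add, Polynomial.map_mul, map_add, map_mul, map_sub,
        Polynomial.map_one, map_one, Polynomial.map_C, Polynomial.map_X]
      ring
    have hsum : ∑ R ∈ range (N + 1), C (binProd z w N R) * (binProd w z N R).map C =
        ∑ R ∈ range (N + 1), a ^ R * b ^ (N + 1 - 1 - R) := by
      refine sum_congr rfl fun R _ => ?_
      simp only [binProd, ha, hb, Polynomial.map_mul, Polynomial.map_pow, map_mul, map_pow,
        mul_pow, Nat.add_sub_cancel]
      ring
    rw [hsum, mul_right_comm, hab, mul_comm, geom_sum₂_mul]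
    simp only [ha, hb, mul_pow, map_pow, Polynomial.map_pow]

/-- Multiplication by `u - s` relates the coefficients at `(P, Q + 1)` and `(P + 1, Q)`, which
determines all of them by induction on `Q`. -/
lemma mul_pairSum (z w : A) (N P Q : ℕ) :
    (z - w) * pairSum z w N P Q = ∑ n ∈ range (Q + 1),
      ((N + 1).choose (P + Q + 1 - n) : A) * ((N + 1).choose n : A) *
        (z ^ (P + Q + 1 - n) * w ^ n - w ^ (P + Q + 1 - n) * z ^ n) := by
  obtain ⟨G, hG, hrec⟩ := exists_generating_pairSum z w N
  have hcoeff : ∀ P Q, ((G * (X - C X)).coeff Q).coeff P =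
      ((N + 1).choose P * w ^ P) * ((N + 1).choose Q * z ^ Q) -
        ((N + 1).choose P * z ^ P) * ((N + 1).choose Q * w ^ Q) := fun P Q => by
    rw [hrec, coeff_sub, coeff_sub, coeff_coeff_C_mul_map_C, coeff_coeff_C_mul_map_C]
    simp only [coeff_one_add_C_mul_X_pow]
  rw [← hG]
  induction Q generalizing P with
  | zero =>
    have h := hcoeff (P + 1) 0
    rw [mul_sub, coeff_sub, coeff_mul_C, mul_coeff_zero, coeff_X_zero, mul_zero, zero_sub,
      coeff_neg, coeff_mul_X] at h
    simp only [zero_add, sum_range_one, add_zero, Nat.sub_zero]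
    linear_combination -h
  | succ Q ih =>
    have h := hcoeff (P + 1) (Q + 1)
    rw [mul_sub, coeff_sub, coeff_mul_C, coeff_mul_X, coeff_sub, coeff_mul_X, ih] at h
    rw [sum_range_succ, show P + (Q + 1) + 1 - (Q + 1) = P + 1 by omega,
      show P + (Q + 1) + 1 = P + 1 + Q + 1 by omega]
    linear_combination -h

end GeneratingFunction

/-! ### The coefficients -/

lemma poch_succ (x : ℚ) (k : ℕ) : poch x (k + 1) = poch x k * (x + k) :=
  Finset.prod_range_succ _ _

lemma poch_natCast_add_one (x k : ℕ) : poch ((x : ℚ) + 1) k * (x ! : ℚ) = ((x + k)! : ℚ) := by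
  induction k with
  | zero => simp [poch]
  | succ k ih =>
    rw [poch_succ, ← add_assoc, Nat.factorial_succ]
    push_cast
    linear_combination ((x : ℚ) + 1 + k) * ih

lemma poch_neg_natCast (x k : ℕ) :
    poch (-((x + k : ℕ) : ℚ)) k * (-1) ^ k * (x ! : ℚ) = ((x + k)! : ℚ) := by
  have h : ∀ j y : ℕ, poch (-((y + j : ℕ) : ℚ)) j * (-1) ^ j = poch ((y : ℚ) + 1) j := by
    intro j y
    simp only [poch]
    have hsign : (-1 : ℚ) ^ j = ∏ _i ∈ Finset.range j, (-1) := by simp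
    rw [← Finset.prod_range_reflect (fun i : ℕ => (y : ℚ) + 1 + i), hsign,
      ← Finset.prod_mul_distrib]
    refine Finset.prod_congr rfl fun i hi => ?_
    have : ((j - 1 - i : ℕ) : ℚ) = j - 1 - i := by
      have := Finset.mem_range.1 hi
      rw [Nat.cast_sub (by omega), Nat.cast_sub (by omega), Nat.cast_one]
    rw [this]
    push_cast
    ring
  rw [h, poch_natCast_add_one]

/-- The coefficients are quotients of products of binomial coefficients. -/
lemma coeffC_eq {N : ℕ} {p q : Fin (N + 1)} (hqp : (q : ℕ) ≤ p) (hpq : (q : ℕ) + p ≤ N) {n : ℕ}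
    (hn : n ≤ q) : coeffC N p q n = ((N + 1).choose (p + q + 1 - n) * (N + 1).choose n : ℚ) /
      (N.choose p * N.choose q) := by
  obtain ⟨P, hP⟩ := p
  obtain ⟨Q, hQ⟩ := q
  simp only at hqp hpq hn ⊢
  obtain ⟨k, rfl⟩ := Nat.exists_eq_add_of_le hn
  obtain ⟨b, rfl⟩ := Nat.exists_eq_add_of_le hpq
  have e1 : wt (n + k + P + b) ⟨P, hP⟩ - spin (n + k + P + b) = -((n + b + k : ℕ) : ℚ) := by
    simp only [wt, spin]
    push_cast
    ring
  have e2 : spin (n + k + P + b) + wt (n + k + P + b) ⟨P, hP⟩ = P := by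
    simp only [wt, spin]
    ring
  have e3 : 2 * spin (n + k + P + b) + 2 - n = ((k + P + b + 1 : ℕ) : ℚ) + 1 := by
    simp only [spin]
    push_cast
    ring
  have e4 : 2 * spin (n + k + P + b) + 1 = n + k + P + b + 1 := by
    simp only [spin]
    push_cast
    ring
  have h1 := poch_neg_natCast (n + b) k
  have h2 := poch_natCast_add_one (P + 1) k
  have h3 := poch_natCast_add_one (k + P + b + 1) n
  rw [coeffC, e1, e2, e3, e4, show n + k - n = k by omega,
    show n + k + P + b - (n + k) = P + b by omega]
  rw [Nat.cast_choose ℚ (show P + (n + k) + 1 - n ≤ n + k + P + b + 1 by omega),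
    Nat.cast_choose ℚ (show n ≤ n + k + P + b + 1 by omega),
    Nat.cast_choose ℚ (show P ≤ n + k + P + b by omega),
    Nat.cast_choose ℚ (show n + k ≤ n + k + P + b by omega),
    show P + (n + k) + 1 - n = P + 1 + k by omega,
    show n + k + P + b + 1 - (P + 1 + k) = n + b by omega,
    show n + k + P + b + 1 - n = k + P + b + 1 by omega,
    show n + k + P + b - P = n + b + k by omega,
    show n + k + P + b - (n + k) = P + b by omega]
  rw [show k + P + b + 1 + n = n + k + P + b + 1 by omega] at h3
  rw [show ((P + 1 : ℕ) : ℚ) + 1 = P + 2 by push_cast; ring, Nat.factorial_succ] at h2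
  have hf : ∀ n : ℕ, (n ! : ℚ) ≠ 0 := fun n => by exact_mod_cast n.factorial_ne_zero
  have i1 := eq_div_of_mul_eq (hf _) h1
  have i2 := eq_div_of_mul_eq (by exact_mod_cast mul_ne_zero P.succ_ne_zero P.factorial_ne_zero) h2
  have i3 := eq_div_of_mul_eq (hf _) h3
  have hP1 : (P : ℚ) + 1 ≠ 0 := by positivity
  rw [i2, i3]
  calc _ = ((n : ℚ) + k + P + b + 1) / (P + 1) * ((P + b)! * (n + k)! / (n + k + P + b)!) *
        ((poch (-((n + b + k : ℕ) : ℚ)) k * (-1) ^ k) /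
          ((P + 1 + k)! / (((P + 1) * P ! : ℕ) : ℚ))) *
        (((n + k + P + b + 1)! : ℚ) / (k + P + b + 1)! / n !) := by ring
    _ = _ := by
      rw [i1, Nat.factorial_succ (n + k + P + b)]
      have g1 := hf (n + k + P + b)
      have g2 := hf (P + b)
      have g3 := hf (n + k)
      have g4 := hf (n + b)
      have g5 := hf (P + 1 + k)
      have g6 := hf (k + P + b + 1)
      have g7 := hf n
      have g8 := hf P
      have g9 := hf (n + b + k)
      push_cast
      field_simp

lemma coeffC_pos {N : ℕ} {p q : Fin (N + 1)} (hqp : (q : ℕ) ≤ p) (hpq : (q : ℕ) + p ≤ N) {n : ℕ}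
    (hn : n ≤ q) : 0 < coeffC N p q n := by
  have hp := p.is_lt
  have hq := q.is_lt
  rw [coeffC_eq hqp hpq hn]
  have h1 := Nat.choose_pos (show (p : ℕ) + q + 1 - n ≤ N + 1 by omega)
  have h2 := Nat.choose_pos (show n ≤ N + 1 by omega)
  have h3 := Nat.choose_pos (show (p : ℕ) ≤ N by omega)
  have h4 := Nat.choose_pos (show (q : ℕ) ≤ N by omega)
  positivity

/-! ### Powers of linear forms -/

open MvPolynomial in
/-- The `N`-th power of the linear form `v 0 * x + v 1 * y`, as an element of `H^ℓ`. -/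
def powLin (N : ℕ) (v : Fin 2 → ℂ) : H N :=
  ⟨(∑ i, C (v i) * X i) ^ N, by
    rw [mem_homogeneousSubmodule]
    simpa using IsHomogeneous.pow (IsHomogeneous.sum Finset.univ _ (0 + 1) fun i _ =>
      (isHomogeneous_C (Fin 2) (v i)).mul (isHomogeneous_X ℂ i)) N⟩

/-- The coefficient of `ψ_j`, for `m = ℓ + j`, in the power of a linear form. -/
def powCoef (N : ℕ) (v : Fin 2 → ℂ) (m : ℕ) : ℂ :=
  v 0 ^ (N - m) * v 1 ^ m * ((Real.sqrt (N.choose m) : ℝ) : ℂ)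

lemma powLin_eq_sum (N : ℕ) (v : Fin 2 → ℂ) :
    powLin N v = ∑ m : Fin (N + 1), powCoef N v m • psi N m := by
  apply Subtype.ext
  rw [AddSubmonoidClass.coe_finsetSum]
  simp only [powLin, Fin.sum_univ_two, SetLike.val_smul, psi]
  rw [add_comm, add_pow, Finset.sum_range]
  refine Finset.sum_congr rfl fun m _ => ?_
  have hm : (m : ℕ) ≤ N := Nat.lt_succ_iff.1 m.is_lt
  have hs : ((Real.sqrt (N.choose m) : ℝ) : ℂ) * ((Real.sqrt (N.choose m) : ℝ) : ℂ) =
      N.choose m := by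
    rw [← Complex.ofReal_mul, Real.mul_self_sqrt (Nat.cast_nonneg _), Complex.ofReal_natCast]
  rw [Nat.choose_symm hm, powCoef, MvPolynomial.smul_monomial, smul_eq_mul, mul_assoc _ _
    ((Real.sqrt (N.choose m) : ℝ) : ℂ), hs, expo, mul_pow, mul_pow, ← map_pow, ← map_pow,
    MvPolynomial.monomial_eq, Finsupp.prod_add_index' (by simp) (by simp [pow_add]),
    Finsupp.prod_single_index (by simp), Finsupp.prod_single_index (by simp)]
  simp only [map_mul, map_natCast]
  ring

lemma inner_psi_powLin (N : ℕ) (v : Fin 2 → ℂ) (i : Fin (N + 1)) :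
    inner ℂ (psi N i) (powLin N v) = powCoef N v i := by
  rw [← psiBasis_apply, powLin_eq_sum]
  simp only [← psiBasis_apply]
  exact (psiBasis N).orthonormal.inner_right_fintype _ i

lemma powLin_smul (N : ℕ) (c : ℂ) (v : Fin 2 → ℂ) : powLin N (c • v) = c ^ N • powLin N v := by
  apply Subtype.ext
  simp only [powLin, SetLike.val_smul, Pi.smul_apply, smul_eq_mul, map_mul, mul_assoc]
  rw [← Finset.mul_sum, mul_pow, ← map_pow, MvPolynomial.smul_eq_C_mul]

lemma T_powLin (N : ℕ) (k : K) (v : Fin 2 → ℂ) :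
    T N k (powLin N v) = powLin N ((k : Matrix (Fin 2) (Fin 2) ℂ) *ᵥ v) := by
  apply Subtype.ext
  change subst (k : Matrix (Fin 2) (Fin 2) ℂ) (powLin N v : MvPolynomial (Fin 2) ℂ) = _
  simp only [powLin, map_pow, subst, Fin.sum_univ_two, map_add, map_mul, MvPolynomial.aeval_X,
    MvPolynomial.algHom_C, Matrix.mulVec, dotProduct, Matrix.transpose_apply,
    MvPolynomial.algebraMap_eq]
  ring

lemma powLin_one_zero (N : ℕ) : powLin N ![1, 0] = psi N 0 := by
  apply Subtype.ext
  simp [powLin, psi, expo, MvPolynomial.X_pow_eq_monomial]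

/-- The powers of the linear forms `x + z y` span `H^ℓ`. -/
lemma linearMap_ext_powLin {N : ℕ} {E : Type*} [NormedAddCommGroup E] [InnerProductSpace ℂ E]
    {f g : H N →ₗ[ℂ] E} (h : ∀ z : ℂ, f (powLin N ![1, z]) = g (powLin N ![1, z])) : f = g := by
  refine (psiBasis N).toBasis.ext fun m => ?_
  rw [OrthonormalBasis.coe_toBasis, psiBasis_apply]
  refine ext_inner_left ℂ fun e => ?_
  -- The inner products of both sides with `e` are polynomial functions of `z`.
  let pol : (H N →ₗ[ℂ] E) → Polynomial ℂ := fun L => ∑ j : Fin (N + 1),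
    Polynomial.monomial (j : ℕ) (((Real.sqrt (N.choose j) : ℝ) : ℂ) * inner ℂ e (L (psi N j)))
  have heval : ∀ L z, (pol L).eval z = inner ℂ e (L (powLin N ![1, z])) := fun L z => by
    simp only [pol, Polynomial.eval_finsetSum, Polynomial.eval_monomial, powLin_eq_sum, map_sum,
      map_smul, inner_sum, inner_smul_right, powCoef]
    refine Finset.sum_congr rfl fun j _ => ?_
    simp
    ring
  have hcoeff : ∀ L, (pol L).coeff m =
      ((Real.sqrt (N.choose m) : ℝ) : ℂ) * inner ℂ e (L (psi N m)) := fun L => by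
    simp [pol, Polynomial.finsetSum_coeff, Polynomial.coeff_monomial, Fin.val_inj]
  have hpol : pol f = pol g := Polynomial.funext fun z => by rw [heval, heval, h]
  have hne := sqrt_choose_ne_zero N m
  rw [Nat.choose_symm (Nat.lt_succ_iff.1 m.is_lt)] at hne
  exact mul_left_cancel₀ hne (by rw [← hcoeff, ← hcoeff, hpol])

/-! ### The isometric intertwiner -/

/-- The scalar by which `T^ℓ(m_t)` acts on `ψ_j`, where `i = ℓ + j`. -/
def torusChar (N i : ℕ) (t : ℝ) : ℂ := Complex.exp (Complex.I * t / 2 * ((N : ℂ) - 2 * i))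

lemma T_m_psi (N : ℕ) (t : ℝ) (i : Fin (N + 1)) :
    T N (m t) (psi N i) = torusChar N i t • psi N i := by
  apply Subtype.ext
  change subst (mMat t) (psi N i : MvPolynomial (Fin 2) ℂ) = _
  have hi : ((N - (i : ℕ) : ℕ) : ℂ) = N - (i : ℕ) := Nat.cast_sub (Nat.lt_succ_iff.1 i.is_lt)
  have hch : torusChar N i t = Complex.exp (Complex.I * t / 2) ^ (N - (i : ℕ)) *
      Complex.exp (-(Complex.I * t / 2)) ^ (i : ℕ) := by
    rw [← Complex.exp_nat_mul, ← Complex.exp_nat_mul, ← Complex.exp_add, torusChar, hi]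
    congr 1
    ring
  rw [SetLike.val_smul, hch]
  simp only [psi, expo, subst, mMat, MvPolynomial.aeval_monomial, MvPolynomial.algebraMap_eq,
    Matrix.diagonal_transpose, Fin.sum_univ_two]
  rw [Finsupp.prod_add_index' (by simp) (by simp [pow_add]),
    Finsupp.prod_single_index (by simp), Finsupp.prod_single_index (by simp),
    MvPolynomial.smul_monomial, MvPolynomial.monomial_eq,
    Finsupp.prod_add_index' (by simp) (by simp [pow_add]),
    Finsupp.prod_single_index (by simp), Finsupp.prod_single_index (by simp)]
  simp [mul_pow]
  ring

/-- The orthonormal basis `ψ_i ⊗ ψ_j` of `H^{ℓ₁} ⊗ H^{ℓ₂}`. -/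
def tensorBasis (N₁ N₂ : ℕ) :
    OrthonormalBasis (Fin (N₁ + 1) × Fin (N₂ + 1)) ℂ (H N₁ ⊗[ℂ] H N₂) :=
  (psiBasis N₁).tensorProduct (psiBasis N₂)

lemma tensorBasis_apply (N₁ N₂ : ℕ) (ij : Fin (N₁ + 1) × Fin (N₂ + 1)) :
    tensorBasis N₁ N₂ ij = psi N₁ ij.1 ⊗ₜ psi N₂ ij.2 := by
  rw [tensorBasis, OrthonormalBasis.tensorProduct_apply', psiBasis_apply, psiBasis_apply]

lemma inner_tensor_smul_right {N₁ N₂ : ℕ} (x y : H N₁ ⊗[ℂ] H N₂) (c : ℂ) :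
    inner ℂ x (c • y) = c * inner ℂ x y := by
  have h := inner_smul_right x y c
  exact h

/-- The squared coefficient of `ψ_i ⊗ ψ_j` in the image of `ψ_{i + j}` under the intertwiner. -/
def cgSq (N₁ N₂ : ℕ) (ij : ℕ × ℕ) : ℝ :=
  N₁.choose ij.1 * N₂.choose ij.2 / (N₁ + N₂).choose (ij.1 + ij.2)

lemma cgSq_nonneg (N₁ N₂ : ℕ) (ij : ℕ × ℕ) : 0 ≤ cgSq N₁ N₂ ij := by
  unfold cgSq
  positivity

/-- Sums over the tensor basis, restricted to a weight space. -/
lemma sum_cgSq (N₁ N₂ q : ℕ) (f : ℕ × ℕ → ℂ) :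
    (∑ ij : Fin (N₁ + 1) × Fin (N₂ + 1), if (ij.1 : ℕ) + ij.2 = q then
      (cgSq N₁ N₂ (ij.1, ij.2) : ℂ) * f (ij.1, ij.2) else 0) =
    ∑ ij ∈ Finset.HasAntidiagonal.antidiagonal q, (cgSq N₁ N₂ ij : ℂ) * f ij := by
  rw [← Finset.sum_filter]
  refine Finset.sum_bij_ne_zero (fun ij _ _ => ((ij.1 : ℕ), (ij.2 : ℕ))) ?_ ?_ ?_ ?_
  · intro ij hij _
    simpa using hij
  · intro ij _ _ ij' _ _ h
    simpa [Prod.ext_iff, Fin.ext_iff] using h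
  · intro ij hij hne
    have h1 : ij.1 ≤ N₁ := by
      by_contra! hlt
      simp [cgSq, Nat.choose_eq_zero_of_lt hlt] at hne
    have h2 : ij.2 ≤ N₂ := by
      by_contra! hlt
      simp [cgSq, Nat.choose_eq_zero_of_lt hlt] at hne
    exact ⟨(⟨ij.1, by omega⟩, ⟨ij.2, by omega⟩), by simpa using hij, hne, rfl⟩
  · intro ij _ _
    rfl

/-- The map `ψ_q ↦ ∑_{i + j = q} (C(N₁, i) C(N₂, j) / C(N₁ + N₂, q))^(1/2) ψ_i ⊗ ψ_j`. It is the
adjoint of the multiplication of polynomials. -/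
def comult (N₁ N₂ : ℕ) : H (N₁ + N₂) →ₗ[ℂ] H N₁ ⊗[ℂ] H N₂ :=
  (psiBasis (N₁ + N₂)).toBasis.constr ℂ fun q => ∑ ij : Fin (N₁ + 1) × Fin (N₂ + 1),
    (if (ij.1 : ℕ) + ij.2 = q then ((Real.sqrt (cgSq N₁ N₂ (ij.1, ij.2)) : ℝ) : ℂ) else 0) •
      tensorBasis N₁ N₂ ij

lemma inner_tensorBasis_comult (N₁ N₂ : ℕ) (q : Fin (N₁ + N₂ + 1))
    (ij : Fin (N₁ + 1) × Fin (N₂ + 1)) :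
    inner ℂ (tensorBasis N₁ N₂ ij) (comult N₁ N₂ (psi _ q)) =
      if (ij.1 : ℕ) + ij.2 = q then ((Real.sqrt (cgSq N₁ N₂ (ij.1, ij.2)) : ℝ) : ℂ) else 0 := by
  have h : comult N₁ N₂ (psi _ q) = ∑ ij : Fin (N₁ + 1) × Fin (N₂ + 1),
      (if (ij.1 : ℕ) + ij.2 = q then ((Real.sqrt (cgSq N₁ N₂ (ij.1, ij.2)) : ℝ) : ℂ) else 0) •
        tensorBasis N₁ N₂ ij := by
    rw [← psiBasis_apply, ← OrthonormalBasis.coe_toBasis, comult, Module.Basis.constr_basis]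
  rw [h, (tensorBasis N₁ N₂).orthonormal.inner_right_fintype]

lemma comult_powLin (N₁ N₂ : ℕ) (v : Fin 2 → ℂ) :
    comult N₁ N₂ (powLin _ v) = powLin N₁ v ⊗ₜ powLin N₂ v := by
  refine InnerProductSpace.ext_inner_left_basis (tensorBasis N₁ N₂).toBasis fun ij => ?_
  obtain ⟨i, j⟩ := ij
  have hij : (i : ℕ) + j < N₁ + N₂ + 1 := by omega
  rw [OrthonormalBasis.coe_toBasis, powLin_eq_sum (N₁ + N₂), map_sum, inner_sum,
    Finset.sum_eq_single ⟨(i : ℕ) + j, hij⟩]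
  · rw [map_smul, inner_tensor_smul_right, inner_tensorBasis_comult, if_pos rfl, tensorBasis_apply,
      TensorProduct.inner_tmul, inner_psi_powLin, inner_psi_powLin]
    have hc : (0 : ℝ) < (N₁ + N₂).choose ((i : ℕ) + j) := by
      exact_mod_cast Nat.choose_pos (by omega)
    have hs : Real.sqrt ((N₁ + N₂).choose ((i : ℕ) + j)) * Real.sqrt (cgSq N₁ N₂ (i, j)) =
        Real.sqrt (N₁.choose i) * Real.sqrt (N₂.choose j) := by
      rw [← Real.sqrt_mul hc.le, ← Real.sqrt_mul (Nat.cast_nonneg _), cgSq]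
      congr 1
      field_simp
    have hs' := congrArg (fun r : ℝ => (r : ℂ)) hs
    simp only [Complex.ofReal_mul] at hs'
    simp only [powCoef]
    rw [mul_assoc, hs', show N₁ + N₂ - ((i : ℕ) + j) = (N₁ - i) + (N₂ - j) by omega, pow_add,
      pow_add]
    ring
  · intro q _ hq
    rw [map_smul, inner_tensor_smul_right, inner_tensorBasis_comult, if_neg, mul_zero]
    exact fun h => hq (Fin.ext h.symm)
  · simp

lemma sum_antidiagonal_cgSq {N₁ N₂ q : ℕ} (hq : q ≤ N₁ + N₂) :
    ∑ ij ∈ Finset.HasAntidiagonal.antidiagonal q, (cgSq N₁ N₂ ij : ℂ) = 1 := by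
  have hc : ((N₁ + N₂).choose q : ℝ) ≠ 0 := by exact_mod_cast (Nat.choose_pos hq).ne'
  rw [← Complex.ofReal_sum, ← Complex.ofReal_one]
  congr 1
  calc _ = ∑ ij ∈ Finset.HasAntidiagonal.antidiagonal q,
        ((N₁.choose ij.1 * N₂.choose ij.2 : ℕ) : ℝ) / (N₁ + N₂).choose q := by
        refine Finset.sum_congr rfl fun ij hij => ?_
        rw [cgSq, Finset.HasAntidiagonal.mem_antidiagonal.1 hij, Nat.cast_mul]
    _ = 1 := by
        rw [← Finset.sum_div, ← Nat.cast_sum, ← Nat.add_choose_eq, div_self hc]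

lemma ofReal_sqrt_cgSq_mul_self (N₁ N₂ : ℕ) (ij : ℕ × ℕ) :
    ((Real.sqrt (cgSq N₁ N₂ ij) : ℝ) : ℂ) * ((Real.sqrt (cgSq N₁ N₂ ij) : ℝ) : ℂ) =
      cgSq N₁ N₂ ij := by
  rw [← Complex.ofReal_mul, Real.mul_self_sqrt (cgSq_nonneg _ _ _)]

/-- By Vandermonde's identity, `comult` maps the vectors `ψ_q` to an orthonormal family. -/
lemma orthonormal_comult (N₁ N₂ : ℕ) :
    Orthonormal ℂ (comult N₁ N₂ ∘ (psiBasis (N₁ + N₂)).toBasis) := by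
  rw [orthonormal_iff_ite]
  intro q q'
  simp only [Function.comp_apply, OrthonormalBasis.coe_toBasis, psiBasis_apply]
  rw [← (tensorBasis N₁ N₂).sum_inner_mul_inner]
  simp only [← inner_conj_symm (comult N₁ N₂ (psi _ q)), inner_tensorBasis_comult]
  split_ifs with h
  · subst h
    rw [← sum_antidiagonal_cgSq (Nat.lt_succ_iff.1 q.is_lt)]
    have := sum_cgSq N₁ N₂ q fun _ => 1
    simp only [mul_one] at this
    rw [← this]
    refine Finset.sum_congr rfl fun ij _ => ?_
    split_ifs
    · rw [Complex.conj_ofReal, ofReal_sqrt_cgSq_mul_self]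
    · simp
  · refine Finset.sum_eq_zero fun ij _ => ?_
    by_cases h1 : (ij.1 : ℕ) + ij.2 = q
    · rw [if_neg fun h2 => h (Fin.ext (h1.symm.trans h2)), mul_zero]
    · rw [if_neg h1, map_zero, zero_mul]

/-- The map `comult` as a linear isometry. -/
def comultIsometry (N₁ N₂ : ℕ) : H (N₁ + N₂) →ₗᵢ[ℂ] H N₁ ⊗[ℂ] H N₂ :=
  (comult N₁ N₂).isometryOfOrthonormal (v := (psiBasis (N₁ + N₂)).toBasis)
    (by simp) (orthonormal_comult N₁ N₂)

lemma T₂_tmul (N₁ N₂ : ℕ) (k₁ k₂ : K) (f : H N₁) (g : H N₂) :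
    T₂ N₁ N₂ (k₁, k₂) (f ⊗ₜ g) = T N₁ k₁ f ⊗ₜ T N₂ k₂ g := rfl

lemma intertwines_comultIsometry (N₁ N₂ : ℕ) :
    Intertwines N₁ N₂ (N₁ + N₂) (comultIsometry N₁ N₂) := by
  intro k f
  change (comult N₁ N₂ ∘ₗ T _ k) f = (T₂ N₁ N₂ (k, k) ∘ₗ comult N₁ N₂) f
  congr 1
  refine linearMap_ext_powLin fun z => ?_
  simp only [LinearMap.comp_apply, T_powLin, comult_powLin, T₂_tmul]

lemma T₂_tensorBasis (N₁ N₂ : ℕ) (s t : ℝ) (ij : Fin (N₁ + 1) × Fin (N₂ + 1)) :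
    T₂ N₁ N₂ (m s, m t) (tensorBasis N₁ N₂ ij) =
      (torusChar N₁ ij.1 s * torusChar N₂ ij.2 t) • tensorBasis N₁ N₂ ij := by
  rw [tensorBasis_apply, T₂_tmul, T_m_psi, T_m_psi, TensorProduct.smul_tmul_smul]

lemma inner_tensorBasis_T₂ (N₁ N₂ : ℕ) (s t : ℝ) (ij : Fin (N₁ + 1) × Fin (N₂ + 1))
    (x : H N₁ ⊗[ℂ] H N₂) :
    inner ℂ (tensorBasis N₁ N₂ ij) (T₂ N₁ N₂ (m s, m t) x) =
      torusChar N₁ ij.1 s * torusChar N₂ ij.2 t * inner ℂ (tensorBasis N₁ N₂ ij) x := by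
  conv_lhs => rw [← (tensorBasis N₁ N₂).sum_repr' x]
  simp only [map_sum, map_smul, T₂_tensorBasis, inner_sum, inner_tensor_smul_right]
  simp [(tensorBasis N₁ N₂).inner_eq_ite]
  ring

/-- An intertwiner preserves weights, so that it maps `x ^ (N₁ + N₂)` to a multiple of
`x ^ N₁ ⊗ x ^ N₂`. -/
lemma Intertwines.apply_psi_zero {N₁ N₂ : ℕ} {β : H (N₁ + N₂) →ₗᵢ[ℂ] H N₁ ⊗[ℂ] H N₂}
    (hβ : Intertwines N₁ N₂ (N₁ + N₂) β) :
    ∃ c : ℂ, ‖c‖ = 1 ∧ β (psi _ 0) = c • psi N₁ 0 ⊗ₜ psi N₂ 0 := by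
  have hz : ∀ ij : Fin (N₁ + 1) × Fin (N₂ + 1), ij ≠ 0 →
      inner ℂ (tensorBasis N₁ N₂ ij) (β (psi _ 0)) = 0 := by
    rintro ⟨i, j⟩ hij
    have hpos : 0 < (i : ℕ) + j := by
      by_contra h
      exact hij (Prod.ext (Fin.ext (show (i : ℕ) = 0 by omega)) (Fin.ext (show (j : ℕ) = 0 by omega)))
    have hne : ((i : ℂ) + j) ≠ 0 := by exact_mod_cast hpos.ne'
    -- At `t = π / (i + j)` the two weights differ by a sign.
    set t : ℝ := Real.pi / ((i : ℝ) + j) with ht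
    have h := congrArg (fun x => inner ℂ (tensorBasis N₁ N₂ (i, j)) x) (hβ (m t) (psi _ 0))
    simp only [inner_tensorBasis_T₂, T_m_psi, map_smul, inner_tensor_smul_right] at h
    have hchar : torusChar N₁ i t * torusChar N₂ j t = -torusChar (N₁ + N₂) 0 t := by
      rw [torusChar, torusChar, torusChar, ← Complex.exp_add, neg_eq_neg_one_mul,
        ← Complex.exp_pi_mul_I, ← Complex.exp_add, Complex.exp_eq_exp_iff_exists_int]
      refine ⟨-1, ?_⟩
      rw [ht]
      push_cast
      field_simp
      ring
    rw [hchar, Fin.val_zero] at h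
    have hexp : torusChar (N₁ + N₂) 0 t ≠ 0 := Complex.exp_ne_zero _
    have h2 : 2 * torusChar (N₁ + N₂) 0 t *
        inner ℂ (tensorBasis N₁ N₂ (i, j)) (β (psi _ 0)) = 0 := by
      linear_combination h
    exact (mul_eq_zero.1 h2).resolve_left (mul_ne_zero two_ne_zero hexp)
  have hβ0 : β (psi _ 0) =
      inner ℂ (tensorBasis N₁ N₂ 0) (β (psi _ 0)) • psi N₁ 0 ⊗ₜ psi N₂ 0 := by
    conv_lhs => rw [← (tensorBasis N₁ N₂).sum_repr' (β (psi _ 0))]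
    rw [Finset.sum_eq_single 0 (fun ij _ hij => by rw [hz ij hij, zero_smul]) (by simp),
      tensorBasis_apply]
    rfl
  have hnorm : ∀ (N : ℕ) (i : Fin (N + 1)), ‖psi N i‖ = 1 := fun N i => by
    rw [← psiBasis_apply]
    exact (psiBasis N).norm_eq_one i
  refine ⟨_, ?_, hβ0⟩
  have := congrArg norm hβ0
  rw [β.norm_map, norm_smul, TensorProduct.norm_tmul, hnorm, hnorm, hnorm, mul_one, mul_one] at this
  exact this.symm

/-- `SU(2)` acts transitively on the unit sphere of `ℂ²`; up to scaling, this sphere contains every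
vector `(1, z)`. -/
lemma exists_mulVec_eq (z : ℂ) : ∃ (k : K) (c : ℂ), c ≠ 0 ∧
    (k : Matrix (Fin 2) (Fin 2) ℂ) *ᵥ ![1, 0] = c • ![1, z] := by
  set r : ℝ := (Real.sqrt (1 + ‖z‖ ^ 2))⁻¹ with hr
  have hpos : 0 < 1 + ‖z‖ ^ 2 := by positivity
  have hr0 : (r : ℂ) ≠ 0 := by
    exact_mod_cast (inv_pos.2 (Real.sqrt_pos.2 hpos)).ne'
  have hr2 : (r : ℂ) * r * (1 + z * (starRingEnd ℂ) z) = 1 := by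
    rw [Complex.mul_conj']
    norm_cast
    rw [hr, ← mul_inv, Real.mul_self_sqrt hpos.le, inv_mul_cancel₀ hpos.ne']
  refine ⟨⟨!![(r : ℂ), -(r * (starRingEnd ℂ) z); r * z, r], ?_⟩, r, hr0, ?_⟩
  · rw [Matrix.mem_specialUnitaryGroup_iff, Matrix.mem_unitaryGroup_iff]
    constructor
    · ext i j
      fin_cases i <;> fin_cases j <;>
        simp [Matrix.mul_apply, Fin.sum_univ_two, Matrix.star_apply] <;>
        first | linear_combination hr2 | ring
    · rw [Matrix.det_fin_two_of]
      linear_combination hr2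
  · ext i
    fin_cases i <;> simp [Matrix.mulVec, dotProduct, Fin.sum_univ_two]

/-- An intertwiner is determined, up to a phase, by its value at `x ^ (N₁ + N₂)`, because the orbit
of this vector spans. -/
lemma Intertwines.eq_smul_comult {N₁ N₂ : ℕ} {β : H (N₁ + N₂) →ₗᵢ[ℂ] H N₁ ⊗[ℂ] H N₂}
    (hβ : Intertwines N₁ N₂ (N₁ + N₂) β) :
    ∃ c : ℂ, ‖c‖ = 1 ∧ β.toLinearMap = c • comult N₁ N₂ := by
  obtain ⟨c, hc, h0⟩ := hβ.apply_psi_zero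
  refine ⟨c, hc, linearMap_ext_powLin fun z => ?_⟩
  obtain ⟨k, r, hr, hk⟩ := exists_mulVec_eq z
  have h := hβ k (psi _ 0)
  rw [h0, map_smul, T₂_tmul, ← powLin_one_zero, ← powLin_one_zero, ← powLin_one_zero, T_powLin,
    T_powLin, T_powLin, hk, powLin_smul, powLin_smul, powLin_smul, map_smul,
    TensorProduct.smul_tmul_smul, ← pow_add, smul_comm] at h
  have h' := smul_right_injective _ (pow_ne_zero (N₁ + N₂) hr) h
  rw [LinearMap.smul_apply, comult_powLin]
  exact h'

/-! ### The spherical functions of degree zero -/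

/-- The `(P, R)` entry of the full spherical function of degree `0`. -/
def entry (N P R : ℕ) (t : ℝ) : ℂ := ∑ ij ∈ Finset.HasAntidiagonal.antidiagonal R,
  (cgSq P (N - P) ij : ℂ) * (torusChar P ij.1 t * torusChar (N - P) ij.2 (-t))

lemma inner_spherical (N₁ N₂ : ℕ) (t : ℝ) (q : Fin (N₁ + N₂ + 1)) :
    inner ℂ (psi _ q) (spherical N₁ N₂ (N₁ + N₂) (a t) (psi _ q)) =
      ∑ ij ∈ Finset.HasAntidiagonal.antidiagonal (q : ℕ),
        (cgSq N₁ N₂ ij : ℂ) * (torusChar N₁ ij.1 t * torusChar N₂ ij.2 (-t)) := by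
  have h : ∃ β : H (N₁ + N₂) →ₗᵢ[ℂ] H N₁ ⊗[ℂ] H N₂, Intertwines N₁ N₂ (N₁ + N₂) β :=
    ⟨_, intertwines_comultIsometry N₁ N₂⟩
  obtain ⟨c, hc, hβ⟩ := h.choose_spec.eq_smul_comult
  have hcc : (starRingEnd ℂ) c * c = 1 := by
    rw [Complex.conj_mul', hc]
    norm_num
  rw [spherical, dif_pos h, LinearMap.comp_apply, LinearMap.comp_apply,
    LinearMap.adjoint_inner_right, hβ, LinearMap.smul_apply, map_smul, inner_smul_left,
    inner_tensor_smul_right, ← mul_assoc, hcc, one_mul, ← (tensorBasis N₁ N₂).sum_inner_mul_inner,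
    ← sum_cgSq N₁ N₂ q fun ij => torusChar N₁ ij.1 t * torusChar N₂ ij.2 (-t)]
  refine Finset.sum_congr rfl fun ij _ => ?_
  rw [a, inner_tensorBasis_T₂, ← inner_conj_symm, inner_tensorBasis_comult]
  split_ifs
  · rw [Complex.conj_ofReal, ← ofReal_sqrt_cgSq_mul_self]
    ring
  · simp

lemma fullSpherical_zero_apply (N : ℕ) (t : ℝ) (p q : Fin (N + 1)) :
    fullSpherical N 0 (a t) p q = entry N p q t := by
  obtain ⟨M, hM⟩ := Nat.exists_eq_add_of_le (Nat.lt_succ_iff.1 p.is_lt)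
  have hgen : ∀ P : ℕ, P + M = N → inner ℂ (psi N q)
      (spherical P (N - P) N (a t) (psi N q)) = entry N P q t := by
    rintro P rfl
    rw [entry, Nat.add_sub_cancel_left]
    exact inner_spherical P M t q
  rw [fullSpherical, Matrix.of_apply, zero_add, zero_add]
  exact hgen p hM.symm

lemma conj_torusChar (N i : ℕ) (t : ℝ) :
    (starRingEnd ℂ) (torusChar N i t) = torusChar N i (-t) := by
  have h2 : (starRingEnd ℂ) 2 = 2 := map_ofNat _ 2
  simp [torusChar, ← Complex.exp_conj, h2]

lemma conj_entry (N P R : ℕ) (t : ℝ) : (starRingEnd ℂ) (entry N P R t) = entry N P R (-t) := by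
  simp [entry, conj_torusChar]

lemma entry_compl_left {N P : ℕ} (hP : P ≤ N) (R : ℕ) (t : ℝ) :
    entry N (N - P) R t = entry N P R (-t) := by
  rw [entry, entry, ← Finset.Nat.sum_antidiagonal_swap]
  refine Finset.sum_congr rfl fun ij _ => ?_
  simp only [cgSq, Prod.fst_swap, Prod.snd_swap, Nat.sub_sub_self hP, neg_neg]
  rw [mul_comm ((N - P).choose ij.2 : ℝ), add_comm ij.2, add_comm (N - P),
    mul_comm (torusChar _ _ _)]

lemma sum_antidiagonal_eq_sum_range {N R : ℕ} (hR : R ≤ N) (f : ℕ × ℕ → ℂ) :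
    ∑ ij ∈ Finset.HasAntidiagonal.antidiagonal R, f ij =
      ∑ i ∈ Finset.range (N + 1), if i ≤ R then f (i, R - i) else 0 := by
  rw [Finset.Nat.sum_antidiagonal_eq_sum_range_succ_mk, ← Finset.sum_filter]
  congr 1
  ext i
  simp only [Finset.mem_range, Finset.mem_filter]
  omega

/-- Both sides count pairs of subsets of sizes `P` and `R` whose intersection has size `i`. -/
lemma choose_mul_choose_mul_choose_symm {N P R i : ℕ} (hP : P ≤ N) (hR : R ≤ N) (hiP : i ≤ P)
    (hiR : i ≤ R) : N.choose P * (P.choose i * (N - P).choose (R - i)) =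
      N.choose R * (R.choose i * (N - R).choose (P - i)) := by
  by_cases h : P + R - i ≤ N
  · obtain ⟨p, rfl⟩ := Nat.exists_eq_add_of_le hiP
    obtain ⟨r, rfl⟩ := Nat.exists_eq_add_of_le hiR
    obtain ⟨c, rfl⟩ := Nat.exists_eq_add_of_le (show i + p + r ≤ N by omega)
    have hf : ∀ n : ℕ, (n ! : ℚ) ≠ 0 := fun n => by exact_mod_cast n.factorial_ne_zero
    have g1 := hf (i + p)
    have g2 := hf (i + r)
    have g3 := hf (r + c)
    have g4 := hf (p + c)
    have g5 := hf i
    have g6 := hf p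
    have g7 := hf r
    have g8 := hf c
    apply Nat.cast_injective (R := ℚ)
    push_cast
    rw [show i + p + r + c - (i + p) = r + c by omega,
      show i + p + r + c - (i + r) = p + c by omega, show i + p - i = p by omega,
      show i + r - i = r by omega, Nat.cast_choose ℚ hP, Nat.cast_choose ℚ hiP,
      Nat.cast_choose ℚ hR, Nat.cast_choose ℚ hiR, Nat.cast_choose ℚ (show r ≤ r + c by omega),
      Nat.cast_choose ℚ (show p ≤ p + c by omega),
      show i + p + r + c - (i + p) = r + c by omega,
      show i + p + r + c - (i + r) = p + c by omega, show i + p - i = p by omega,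
      show i + r - i = r by omega, show r + c - r = c by omega, show p + c - p = c by omega]
    field_simp
  · rw [Nat.choose_eq_zero_of_lt (show N - P < R - i by omega),
      Nat.choose_eq_zero_of_lt (show N - R < P - i by omega)]
    simp

lemma cgSq_symm {N P R i : ℕ} (hP : P ≤ N) (hR : R ≤ N) (hiP : i ≤ P) (hiR : i ≤ R) :
    cgSq P (N - P) (i, R - i) = cgSq R (N - R) (i, P - i) := by
  have h := choose_mul_choose_mul_choose_symm hP hR hiP hiR
  have hP' : (N.choose P : ℝ) ≠ 0 := by exact_mod_cast (Nat.choose_pos hP).ne'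
  have hR' : (N.choose R : ℝ) ≠ 0 := by exact_mod_cast (Nat.choose_pos hR).ne'
  simp only [cgSq]
  rw [Nat.add_sub_cancel' hP, Nat.add_sub_cancel' hR, Nat.add_sub_cancel' hiP,
    Nat.add_sub_cancel' hiR, div_eq_div_iff hR' hP']
  have h' := congrArg (fun n : ℕ => (n : ℝ)) h
  push_cast at h'
  linear_combination h'

lemma torusChar_mul_torusChar {N P : ℕ} (hP : P ≤ N) (i j : ℕ) (t : ℝ) :
    torusChar P i t * torusChar (N - P) j (-t) =
      Complex.exp (Complex.I * t / 2 * (2 * P - N - 2 * i + 2 * j)) := by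
  rw [torusChar, torusChar, ← Complex.exp_add, Nat.cast_sub hP]
  congr 1
  push_cast
  ring

/-- The full spherical function of degree `0` is a symmetric matrix (the self-duality of the
Krawtchouk polynomials). -/
lemma entry_symm {N P R : ℕ} (hP : P ≤ N) (hR : R ≤ N) (t : ℝ) :
    entry N P R t = entry N R P t := by
  rw [entry, entry, sum_antidiagonal_eq_sum_range hR, sum_antidiagonal_eq_sum_range hP]
  refine Finset.sum_congr rfl fun i _ => ?_
  split_ifs with h1 h2 h2
  · rw [cgSq_symm hP hR h2 h1, torusChar_mul_torusChar hP, torusChar_mul_torusChar hR,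
      Nat.cast_sub h1, Nat.cast_sub h2]
    congr 2
    ring
  · simp [cgSq, Nat.choose_eq_zero_of_lt (not_le.1 h2)]
  · simp [cgSq, Nat.choose_eq_zero_of_lt (not_le.1 h1)]
  · rfl

lemma entry_compl_right {N P R : ℕ} (hP : P ≤ N) (hR : R ≤ N) (t : ℝ) :
    entry N P (N - R) t = entry N P R (-t) := by
  rw [entry_symm hP (Nat.sub_le _ _), entry_compl_left hR, entry_symm hR hP]

lemma choose_mul_entry {N P R : ℕ} (hP : P ≤ N) (hR : R ≤ N) (t : ℝ) :
    (N.choose P : ℂ) * entry N P R t = Complex.exp (Complex.I * t / 2 * (2 * R - N)) *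
      (binProd (Complex.exp (Complex.I * t)) (Complex.exp (-(Complex.I * t))) N R).coeff P := by
  have hP' : (N.choose P : ℂ) ≠ 0 := by exact_mod_cast (Nat.choose_pos hP).ne'
  rw [entry_symm hP hR, entry, coeff_binProd, Finset.mul_sum, Finset.mul_sum]
  refine Finset.sum_congr rfl fun ij hij => ?_
  rw [torusChar_mul_torusChar hR, cgSq, Finset.HasAntidiagonal.mem_antidiagonal.1 hij,
    Nat.add_sub_cancel' hR]
  have hexp : Complex.exp (Complex.I * t / 2 * (2 * R - N - 2 * ij.1 + 2 * ij.2)) =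
      Complex.exp (Complex.I * t / 2 * (2 * R - N)) * Complex.exp (-(Complex.I * t)) ^ ij.1 *
        Complex.exp (Complex.I * t) ^ ij.2 := by
    rw [← Complex.exp_nat_mul, ← Complex.exp_nat_mul, ← Complex.exp_add, ← Complex.exp_add]
    congr 1
    ring
  rw [hexp]
  push_cast
  field_simp

/-! ### The weight matrix -/

/-- The `(P, Q)` entry of the weight matrix, without the factor `sin² t`. The complex
conjugate of an entry of the spherical function is its value at `-t`. -/
def weightEntry (N P Q : ℕ) (t : ℝ) : ℂ :=
  ∑ R ∈ Finset.range (N + 1), entry N P R t * entry N Q R (-t)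

lemma V_apply (N : ℕ) (t : ℝ) (p q : Fin (N + 1)) :
    V N t p q = (Real.sin t : ℂ) ^ 2 * weightEntry N p q t := by
  rw [V, Matrix.smul_apply, Matrix.mul_apply, weightEntry, Finset.sum_range, Dstar,
    abs_of_nonneg (sq_nonneg _), smul_eq_mul, Complex.ofReal_pow]
  simp only [Matrix.conjTranspose_apply, fullSpherical_zero_apply, ← conj_entry]
  rfl

lemma choose_mul_weightEntry {N P Q : ℕ} (hP : P ≤ N) (hQ : Q ≤ N) (t : ℝ) :
    (N.choose P : ℂ) * N.choose Q * weightEntry N P Q t =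
      pairSum (Complex.exp (Complex.I * t)) (Complex.exp (-(Complex.I * t))) N P Q := by
  rw [weightEntry, pairSum, Finset.mul_sum]
  refine Finset.sum_congr rfl fun R hR => ?_
  have hR' : R ≤ N := Nat.lt_succ_iff.1 (Finset.mem_range.1 hR)
  have h1 := choose_mul_entry hP hR' t
  have h2 := choose_mul_entry hQ hR' (-t)
  have hphase : Complex.exp (Complex.I * t / 2 * (2 * R - N)) *
      Complex.exp (Complex.I * (-t : ℝ) / 2 * (2 * R - N)) = 1 := by
    rw [← Complex.exp_add, ← Complex.exp_zero]
    congr 1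
    push_cast
    ring
  rw [Complex.ofReal_neg, mul_neg, neg_neg, ← mul_neg, ← Complex.ofReal_neg] at h2
  calc _ = (N.choose P * entry N P R t) * (N.choose Q * entry N Q R (-t)) := by ring
    _ = _ := by
      rw [h1, h2, mul_mul_mul_comm, hphase, one_mul, Complex.ofReal_neg, mul_neg]

/-- The expansion of the weight in the characters `U_k (cos t)` of `SU(2)`; no restriction on the
indices is needed. -/
lemma weightEntry_eq_sum_chebyshev {N P Q : ℕ} (hP : P ≤ N) (hQ : Q ≤ N) {t : ℝ}
    (ht : Real.sin t ≠ 0) : weightEntry N P Q t = ∑ n ∈ Finset.range (Q + 1),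
      ((((N + 1).choose (P + Q + 1 - n) * (N + 1).choose n : ℝ) / (N.choose P * N.choose Q) *
        (Polynomial.Chebyshev.U ℝ ((P : ℤ) + Q - 2 * n)).eval (Real.cos t) : ℝ) : ℂ) := by
  have hP' : (N.choose P : ℂ) ≠ 0 := by exact_mod_cast (Nat.choose_pos hP).ne'
  have hQ' : (N.choose Q : ℂ) ≠ 0 := by exact_mod_cast (Nat.choose_pos hQ).ne'
  have hsin : ∀ x : ℝ, Complex.exp (Complex.I * x) - Complex.exp (-(Complex.I * x)) =
      2 * Complex.I * (Real.sin x : ℝ) := fun x => by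
    rw [mul_comm, Complex.ofReal_sin, ← neg_mul, Complex.exp_mul_I, Complex.exp_mul_I,
      Complex.cos_neg, Complex.sin_neg]
    ring
  have ht' : 2 * Complex.I * (Real.sin t : ℝ) ≠ 0 :=
    mul_ne_zero (mul_ne_zero two_ne_zero Complex.I_ne_zero) (Complex.ofReal_ne_zero.2 ht)
  have h := mul_pairSum (Complex.exp (Complex.I * t)) (Complex.exp (-(Complex.I * t))) N P Q
  rw [← choose_mul_weightEntry hP hQ, hsin] at h
  refine mul_left_cancel₀ (mul_ne_zero ht' (mul_ne_zero hP' hQ')) ?_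
  rw [mul_assoc, h, Finset.mul_sum]
  refine Finset.sum_congr rfl fun n hn => ?_
  have hn' : n ≤ P + Q + 1 := by
    have := Finset.mem_range.1 hn
    omega
  have hU := Polynomial.Chebyshev.U_real_cos t ((P : ℤ) + Q - 2 * n)
  have hpow : Complex.exp (Complex.I * t) ^ (P + Q + 1 - n) * Complex.exp (-(Complex.I * t)) ^ n -
      Complex.exp (-(Complex.I * t)) ^ (P + Q + 1 - n) * Complex.exp (Complex.I * t) ^ n =
      2 * Complex.I * (((Polynomial.Chebyshev.U ℝ ((P : ℤ) + Q - 2 * n)).eval (Real.cos t) : ℝ) *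
        (Real.sin t : ℝ)) := by
    rw [← Complex.ofReal_mul, hU, ← hsin]
    simp only [← Complex.exp_nat_mul, ← Complex.exp_add]
    rw [Nat.cast_sub hn']
    congr 2 <;> push_cast <;> ring
  rw [hpow]
  push_cast
  field_simp

end SU2Pair

end

open SU2Pair in
theorem mainTheorem2 (N : ℕ) :
    (∀ p q : Fin (N + 1),
      SU2Pair.wt N q - SU2Pair.wt N p ≤ 0 → SU2Pair.wt N q + SU2Pair.wt N p ≤ 0 →
        (∀ n ∈ Finset.range ((q : ℕ) + 1), 0 < SU2Pair.coeffC N p q n) ∧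
        ∀ t : ℝ, SU2Pair.V N t p q =
          ((Real.sin t ^ 2 * ∑ n ∈ Finset.range ((q : ℕ) + 1), (SU2Pair.coeffC N p q n : ℝ) *
            (Polynomial.Chebyshev.U ℝ ((p : ℤ) + (q : ℤ) - 2 * (n : ℤ))).eval (Real.cos t) : ℝ) :
              ℂ)) ∧
    (∀ (p q : Fin (N + 1)) (t : ℝ),
      SU2Pair.V N t p q = SU2Pair.V N t q p ∧
      SU2Pair.V N t p q = SU2Pair.V N t (Fin.rev p) (Fin.rev q) ∧
      SU2Pair.V N t p q = SU2Pair.V N t (Fin.rev q) (Fin.rev p)) := by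
  have hle : ∀ p : Fin (N + 1), (p : ℕ) ≤ N := fun p => Nat.lt_succ_iff.1 p.is_lt
  refine ⟨fun p q h1 h2 => ?_, fun p q t => ?_⟩
  · have hqp : (q : ℕ) ≤ p := by
      simp only [wt] at h1
      exact_mod_cast (by linarith : ((q : ℕ) : ℚ) ≤ (p : ℕ))
    have hpq : (q : ℕ) + p ≤ N := by
      simp only [wt, spin] at h2
      exact_mod_cast (by linarith : ((q : ℕ) : ℚ) + (p : ℕ) ≤ N)
    have hn : ∀ n ∈ Finset.range ((q : ℕ) + 1), n ≤ q := fun n hn =>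
      Nat.lt_succ_iff.1 (Finset.mem_range.1 hn)
    refine ⟨fun n h => coeffC_pos hqp hpq (hn n h), fun t => ?_⟩
    rw [V_apply, Complex.ofReal_mul, Complex.ofReal_pow]
    -- At the zeros of `sin t` both sides vanish; elsewhere the factor `sin t` can be cancelled.
    by_cases ht : Real.sin t = 0
    · simp [ht]
    · rw [weightEntry_eq_sum_chebyshev (hle p) (hle q) ht, Complex.ofReal_sum]
      congr 1
      refine Finset.sum_congr rfl fun n h => ?_
      rw [coeffC_eq hqp hpq (hn n h)]
      push_cast
      rfl
  · have hrev : ∀ p : Fin (N + 1), ((Fin.rev p : Fin (N + 1)) : ℕ) = N - p := fun p => by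
      rw [Fin.val_rev]
      omega
    have hswap : weightEntry N p q t = weightEntry N q p t := by
      rw [weightEntry, weightEntry, ← Finset.sum_range_reflect]
      refine Finset.sum_congr rfl fun R hR => ?_
      have hR' : R ≤ N := Nat.lt_succ_iff.1 (Finset.mem_range.1 hR)
      rw [Nat.add_sub_cancel, entry_compl_right (hle p) hR', entry_compl_right (hle q) hR',
        neg_neg, mul_comm]
    have hcompl : ∀ p q : Fin (N + 1),
        weightEntry N (N - p) (N - q) t = weightEntry N q p t := fun p q => by
      rw [weightEntry, weightEntry]
      refine Finset.sum_congr rfl fun R _ => ?_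
      rw [entry_compl_left (hle p), entry_compl_left (hle q), neg_neg, mul_comm]
    simp only [V_apply, hrev, hcompl, hswap, and_self]
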